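/- Let $(Y,\|\cdot\|)$ be a real normed space of dimension at least $2$ with topological dual $Y^*$. A set $C\subseteq Y$ is a cone if $0\in C=\mathbb R_+\cdot C$; it is nontrivial if $\{0\}\ne C\ne Y$. Put $\ell(C):=C\cap(-C)$. For a norm $\psi$ on $Y$ and a cone $C$ put $B_C(\psi):=\{y\in C\mid\psi(y)=1\}$, $S_C(\psi):=\operatorname{conv}B_C(\psi)$, $C_\psi(x^*,\alpha):=\{y\in Y\mid x^*(y)\ge\alpha\psi(y)\}$ for $x^*\in Y^*$, $\alpha\ge 0$, and $$C^{a\#}(\psi):=\{(x^*,\alpha)\in Y^*\times\mathbb R_+\mid \forall y\in C\setminus\{0\}:\ x^*(y)>0\text{ and }x^*(y)-\alpha\psi(y)>0\}.$$ Let $\Omega$ be a nonempty feasible set in a real topological vector space $X$ and $f:X\to Y$. For a cone $C$, $\operatorname{Eff}(\Omega\mid f,C)$ is the set of $\bar x\in\Omega$ for which there is no $x\in\Omega$ with $f(x)\in f(\bar x)-C\setminus\{0\}$. For a map $\mathbb A:\Omega\to 2^Y$ whose values are cones, $\operatorname{PEff}_{\mathbb A}(\Omega\mid f,C)$ is the set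 of $\bar x\in\operatorname{Eff}(\Omega\mid f,C)$ with $\mathbb A(\bar x)\cap(-C)=\{0\}$. Let $K\subseteq Y$ be a nontrivial, closed, convex cone with $0\notin\operatorname{cl}S_{-K}(\|\cdot\|)$, let $\bar x\in\operatorname{PEff}_{\mathbb A}(\Omega\mid f,K)$, and suppose that $A:=\mathbb A(\bar x)$ satisfies $\{0\}\ne f[\Omega]-f(\bar x)\subseteq A$. Assume that one of the following holds ($\operatorname{cl}_w$ denotes weak closure): a) $B_A(\|\cdot\|)$ and $\operatorname{cl}S_{-K}(\|\cdot\|)$ are compact; b) $A$ is weakly closed, and either $Y$ is reflexive, or $\operatorname{cl}S_{-K}(\|\cdot\|)$ and $\operatorname{cl}_wB_A(\|\cdot\|)$ are weakly compact and $0\notin\operatorname{cl}_wB_A(\|\cdot\|)$. Then there are a norm $\|\cdot\|'$ on $Y$ equivalent to $\|\cdot\|$ and a pair $(x^*,\alpha)\in K^{a\#}(\|\cdot\|')$ with $\alpha>0$ such that, with $C:=C_{\|\cdot\|'}(x^*,\alpha)$, $\bar x\in\operatorname{Eff}(\Omega\mid f,C)$. Moreover, for every sublinear $\varphi:Y\to\mathbb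 R$ with $\varphi(0)=0$ and $-C=\{y\in Y\mid\varphi(y)\le 0\}$, the following hold, where $(P_\varphi^{a,k})$ is the problem of minimizing $\lambda$ subject to $(x,\lambda)\in\Omega\times\mathbb R$, $\varphi(f(x)-a-\lambda k)\le 0$: 1) for every $k\in C\setminus\ell(C)$, the set of solutions of $(P_\varphi^{a,k})$ with $a=f(\bar x)$ is $\{(x,0)\mid x\in\Omega,\ f(x)=f(\bar x)\}$; 2) $\{x\in\Omega\mid f(x)=f(\bar x)\}=\operatorname{argmin}_{x\in\Omega}\varphi(f(x)-f(\bar x))$; 3) for all sets $\mathcal P\subseteq Y$, $\mathcal T\subseteq C\setminus\ell(C)$, $\mathcal R\subseteq\mathbb R$ with $f[\operatorname{Eff}(\Omega\mid f,C)]\subseteq\mathcal P+\mathcal R\cdot\mathcal T$: there are $a\in\mathcal P$, $k\in\mathcal T$, $s\in\mathcal R$ such that $\{(x,s)\mid x\in\Omega,\ f(x)=f(\bar x)\}$ is the set of solutions of $(P_\varphi^{a,k})$; and there are $a\in\mathcal P$, $k\in\mathcal T$, $s\in\mathcal R$ such that $\varphi^G_{a-C,k}(f(\bar x))=s$ and $\{x\in\Omega\mid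 f(x)=f(\bar x)\}=\operatorname{argmin}_{x\in\Omega}\varphi^G_{a-C,k}(f(x))$, where $\varphi^G_{a-C,k}(y):=\inf\{t\in\mathbb R\mid y\in tk+(a-C)\}\in\mathbb R\cup\{\pm\infty\}$. -/

import Mathlib

open scoped Pointwise

namespace BPScal

section Cones

variable {Y : Type*} [AddCommGroup Y] [Module ℝ Y]

/-- A cone: `0 ∈ K = ℝ₊ · K` (no convexity). -/
def IsCone (K : Set Y) : Prop :=
  (0 : Y) ∈ K ∧ Set.Ici (0 : ℝ) • K = K

/-- A cone is nontrivial if `{0} ≠ K ≠ Y`. -/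
def IsNontrivialCone (K : Set Y) : Prop :=
  IsCone K ∧ K ≠ {0} ∧ K ≠ Set.univ

/-- `ℓ(K) = K ∩ (-K)`. -/
def lineality (K : Set Y) : Set Y := K ∩ (-K)

/-- `B_K(ψ) = {x ∈ K | ψ(x) = 1}`. -/
def normBase (K : Set Y) (ψ : Seminorm ℝ Y) : Set Y := {x ∈ K | ψ x = 1}

/-- `S_K(ψ) = conv B_K(ψ)`. -/
def convBase (K : Set Y) (ψ : Seminorm ℝ Y) : Set Y := convexHull ℝ (normBase K ψ)

/-- `φ` is sublinear: positively homogeneous and subadditive. -/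
def IsSublinear (φ : Y → ℝ) : Prop :=
  (∀ (t : ℝ) (y : Y), 0 ≤ t → φ (t • y) = t * φ y) ∧ ∀ y z : Y, φ (y + z) ≤ φ y + φ z

/-- `φ` is `-C` representing: `-C = {y | φ(y) ≤ 0}`. -/
def IsNegRepresenting (φ : Y → ℝ) (C : Set Y) : Prop := -C = {y | φ y ≤ 0}

end Cones

section Normed

variable {Y : Type*} [NormedAddCommGroup Y] [NormedSpace ℝ Y]

/-- `p` is a norm equivalent to the given norm of `Y` (the lower bound makes the seminorm `p`
a norm). -/
def IsEquivalentNorm (p : Seminorm ℝ Y) : Prop :=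
  ∃ c C : ℝ, 0 < c ∧ 0 < C ∧ ∀ y : Y, c * ‖y‖ ≤ p y ∧ p y ≤ C * ‖y‖

/-- `C_ψ(x*, α) = {y | x*(y) ≥ α ψ(y)}`. -/
def bpCone (ψ : Seminorm ℝ Y) (xs : StrongDual ℝ Y) (α : ℝ) : Set Y :=
  {y | α * ψ y ≤ xs y}

/-- `K^# = {y* | y*(k) > 0 for all k ∈ K \ {0}}`. -/
def quasiDual (K : Set Y) : Set (StrongDual ℝ Y) := {xs | ∀ k ∈ K \ {0}, 0 < xs k}

/-- `K^{a#}(ψ)`. -/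
def augQuasiDual (K : Set Y) (ψ : Seminorm ℝ Y) : Set (StrongDual ℝ Y × ℝ) :=
  {q | q.1 ∈ quasiDual K ∧ 0 ≤ q.2 ∧ ∀ y ∈ K \ {0}, 0 < q.1 y - q.2 * ψ y}

/-- Reflexivity: the canonical embedding into the bidual is onto. -/
def IsReflexive (Y : Type*) [NormedAddCommGroup Y] [NormedSpace ℝ Y] : Prop :=
  Function.Surjective (NormedSpace.inclusionInDoubleDual ℝ Y)

def IsWeaklyClosed (S : Set Y) : Prop := IsClosed (toWeakSpace ℝ Y '' S)

def IsWeaklyCompact (S : Set Y) : Prop := IsCompact (toWeakSpace ℝ Y '' S)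

/-- The weak closure, as a subset of `Y`. -/
def weakClosure (S : Set Y) : Set Y := toWeakSpace ℝ Y ⁻¹' closure (toWeakSpace ℝ Y '' S)

end Normed

section Optimization

variable {X Y : Type*} [AddCommGroup Y] [Module ℝ Y]

/-- `Eff(Ω | f, K)`: no `x ∈ Ω` satisfies `f(x) ∈ f(x̄) - K \ {0}`. -/
def Eff (Ω : Set X) (f : X → Y) (K : Set Y) : Set X :=
  {xb ∈ Ω | ¬ ∃ x ∈ Ω, f xb - f x ∈ K \ {0}}

/-- `PEff_𝔸(Ω | f, K)`; only the values of `𝔸` on `Ω` matter. -/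
def PEff (𝔸 : X → Set Y) (Ω : Set X) (f : X → Y) (K : Set Y) : Set X :=
  {xb ∈ Eff Ω f K | 𝔸 xb ∩ (-K) = {0}}

/-- The set of minimizers of `g` over `Ω`. -/
def argmin {β : Type*} [LE β] (Ω : Set X) (g : X → β) : Set X :=
  {x ∈ Ω | ∀ x' ∈ Ω, g x ≤ g x'}

/-- Feasible pairs of the problem: minimize `λ` subject to `φ(f(x) - a - λ k) ≤ 0`,
`(x, λ) ∈ Ω × ℝ`. -/
def psFeasible (Ω : Set X) (f : X → Y) (φ : Y → ℝ) (a k : Y) : Set (X × ℝ) :=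
  {q | q.1 ∈ Ω ∧ φ (f q.1 - a - q.2 • k) ≤ 0}

/-- Solutions of the problem: minimize `λ` subject to `φ(f(x) - a - λ k) ≤ 0`,
`(x, λ) ∈ Ω × ℝ`. -/
def psSolutions (Ω : Set X) (f : X → Y) (φ : Y → ℝ) (a k : Y) : Set (X × ℝ) :=
  argmin (psFeasible Ω f φ a k) Prod.snd

/-- Gerstewitz function `φ^G_{a-C,k}(y) = inf {t ∈ ℝ | y ∈ t k + (a - C)}`, with values in the
extended reals. -/
noncomputable def gerstewitz (a : Y) (C : Set Y) (k y : Y) : EReal :=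
  sInf {r : EReal | ∃ t : ℝ, t • k + a - y ∈ C ∧ r = (t : EReal)}

/-- The points of `Ω` with the same value as `xb`. -/
def sameValue (Ω : Set X) (f : X → Y) (xb : X) : Set X := {x ∈ Ω | f x = f xb}

end Optimization

end BPScal

open BPScal

/-!
Put `D := -K`. Compactness makes the difference of `D` and a base of `A` (or of `A` and a base of
`D`) closed, and since it misses `0`, the cones `A` and `D` are at a positive angle. As
`0 ∉ cl S_{-K}`, some functional `x*` satisfies `‖y‖ ≤ x*(y)` on `K`. Symmetrizing the sublinear
function `q(y) = x*(y) + d(y, K)` gives the equivalent norm `p(y) = max (q(y)) (q(-y))`. It equals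
`x*` on `K`, and `α p(y) ≤ x*(y)` forces `α d(y, K) ≤ (1 - α) x*(y)`. So for `α` close to `1` the
cone `C_p(x*, α)` dilates `K` so little that, by the angle condition, it meets `-A` only in `0`.

The scalarization results hold for an arbitrary closed convex cone `C`: if `(x, λ)` is feasible
for `(P_φ^{a,k})` and `λ` is at most the level `s` of an efficient value `f(x̄) = a + s k`, then
`f(x)` lies in `f(x̄) - C`, hence equals `f(x̄)`, and `k ∉ ℓ(C)` then forces `λ = s`.
-/

namespace BPScal

section Cones

variable {Y : Type*} [AddCommGroup Y] [Module ℝ Y] {C : Set Y}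

theorem isCone_iff : IsCone C ↔ (0 : Y) ∈ C ∧ ∀ t : ℝ, 0 ≤ t → ∀ y ∈ C, t • y ∈ C := by
  refine and_congr_right fun _ => ⟨fun h t ht y hy => h ▸ Set.smul_mem_smul ht hy, fun h => ?_⟩
  refine Set.Subset.antisymm ?_ fun y hy => ⟨1, Set.mem_Ici.2 zero_le_one, y, hy, one_smul ℝ y⟩
  rintro _ ⟨t, ht, y, hy, rfl⟩
  exact h t ht y hy

theorem IsCone.zero_mem (hC : IsCone C) : (0 : Y) ∈ C := hC.1

theorem IsCone.smul_mem (hC : IsCone C) {t : ℝ} (ht : 0 ≤ t) {y : Y} (hy : y ∈ C) : t • y ∈ C :=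
  (isCone_iff.1 hC).2 t ht y hy

theorem IsCone.smul_mem_iff (hC : IsCone C) {t : ℝ} (ht : 0 < t) {y : Y} : t • y ∈ C ↔ y ∈ C := by
  refine ⟨fun h => ?_, hC.smul_mem ht.le⟩
  simpa only [inv_smul_smul₀ ht.ne'] using hC.smul_mem (inv_nonneg.2 ht.le) h

theorem IsCone.smul_set_eq (hC : IsCone C) {t : ℝ} (ht : 0 < t) : t • C = C := by
  ext y
  rw [Set.mem_smul_set_iff_inv_smul_mem₀ ht.ne', hC.smul_mem_iff (inv_pos.2 ht)]

theorem IsCone.neg (hC : IsCone C) : IsCone (-C) := by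
  refine isCone_iff.2 ⟨by simpa using hC.zero_mem, fun t ht y hy => ?_⟩
  simpa only [Set.mem_neg, smul_neg] using hC.smul_mem ht hy

theorem IsCone.add_mem (hC : IsCone C) (hconv : Convex ℝ C) {y z : Y} (hy : y ∈ C) (hz : z ∈ C) :
    y + z ∈ C := by
  have hmid : (2⁻¹ : ℝ) • (y + z) ∈ C := by
    rw [smul_add]
    exact hconv hy hz (by norm_num) (by norm_num) (by norm_num)
  exact (hC.smul_mem_iff (by norm_num)).1 hmid

theorem IsCone.smul_mem_iff_nonneg (hC : IsCone C) {k : Y} (hk : k ∈ C \ lineality C) {t : ℝ} :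
    t • k ∈ C ↔ 0 ≤ t := by
  refine ⟨fun h => ?_, fun ht => hC.smul_mem ht hk.1⟩
  by_contra! ht
  refine hk.2 ⟨hk.1, (hC.smul_mem_iff (neg_pos.2 ht)).1 ?_⟩
  rwa [neg_smul_neg]

end Cones

theorem IsNegRepresenting.nonpos_iff {Y : Type*} [AddCommGroup Y] {φ : Y → ℝ} {C : Set Y}
    (h : IsNegRepresenting φ C) (y : Y) : φ y ≤ 0 ↔ -y ∈ C := by
  rw [← Set.mem_neg, h, Set.mem_ofPred_eq]

section Sublinear

variable {Y : Type*} [AddCommGroup Y] [Module ℝ Y] {q r : Y → ℝ}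

/-- The symmetrization `y ↦ max (q y) (q (-y))` of a sublinear function `q`, the least seminorm
above `q`. -/
def IsSublinear.symmetrization (hq : IsSublinear q) : Seminorm ℝ Y :=
  Seminorm.of (fun y => max (q y) (q (-y)))
    (fun y z => by
      refine max_le ((hq.2 y z).trans (add_le_add (le_max_left _ _) (le_max_left _ _))) ?_
      rw [neg_add]
      exact (hq.2 _ _).trans (add_le_add (le_max_right _ _) (le_max_right _ _)))
    (fun t y => by
      rcases le_total 0 t with ht | ht
      · rw [← smul_neg, hq.1 t y ht, hq.1 t (-y) ht, Real.norm_of_nonneg ht,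
          mul_max_of_nonneg _ _ ht]
      · have ht' : 0 ≤ -t := neg_nonneg.2 ht
        rw [← neg_smul, ← neg_smul_neg, hq.1 _ (-y) ht', hq.1 _ y ht', Real.norm_of_nonpos ht,
          mul_max_of_nonneg _ _ ht', max_comm])

theorem IsSublinear.symmetrization_le_iff (hq : IsSublinear q) {y : Y} {c : ℝ} :
    hq.symmetrization y ≤ c ↔ q y ≤ c ∧ q (-y) ≤ c :=
  max_le_iff

theorem IsSublinear.add (hq : IsSublinear q) (hr : IsSublinear r) :
    IsSublinear fun y => q y + r y := by
  refine ⟨fun t y ht => ?_, fun y z => ?_⟩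
  · simp only [hq.1 t y ht, hr.1 t y ht, mul_add]
  · exact (add_le_add (hq.2 y z) (hr.2 y z)).trans_eq (add_add_add_comm _ _ _ _)

end Sublinear

section EquivalentNorm

variable {Y : Type*} [NormedAddCommGroup Y] [NormedSpace ℝ Y] {p : Seminorm ℝ Y}

theorem IsEquivalentNorm.continuous (hp : IsEquivalentNorm p) : Continuous p := by
  obtain ⟨c, C, -, hC, h⟩ := hp
  refine Seminorm.continuous_of_le (q := C.toNNReal • normSeminorm ℝ Y) ?_ fun y => ?_
  · exact continuous_norm.const_smul C.toNNReal
  · simpa [NNReal.smul_def, hC.le] using (h y).2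

theorem isCone_bpCone (p : Seminorm ℝ Y) (xs : StrongDual ℝ Y) (α : ℝ) :
    IsCone (bpCone p xs α) := by
  refine isCone_iff.2 ⟨by simp [bpCone], fun t ht y (hy : α * p y ≤ xs y) => ?_⟩
  change α * p (t • y) ≤ xs (t • y)
  rw [map_smul_eq_mul, map_smul, smul_eq_mul, Real.norm_of_nonneg ht, mul_left_comm]
  exact mul_le_mul_of_nonneg_left hy ht

theorem convex_bpCone (p : Seminorm ℝ Y) (xs : StrongDual ℝ Y) {α : ℝ} (hα : 0 ≤ α) :
    Convex ℝ (bpCone p xs α) := by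
  have hconvex : ConvexOn ℝ Set.univ fun y => α * p y - xs y :=
    (p.convexOn.smul hα).sub (xs.toLinearMap.concaveOn convex_univ)
  simpa [bpCone] using hconvex.convex_le 0

theorem IsEquivalentNorm.isClosed_bpCone (hp : IsEquivalentNorm p) (xs : StrongDual ℝ Y)
    (α : ℝ) : IsClosed (bpCone p xs α) :=
  isClosed_le (hp.continuous.const_mul α) xs.continuous

end EquivalentNorm

section Bases

variable {Y : Type*} [NormedAddCommGroup Y] [NormedSpace ℝ Y] {K : Set Y}

theorem IsCone.inv_norm_smul_mem_normBase (hK : IsCone K) {y : Y} (hy : y ∈ K) (hy0 : y ≠ 0) :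
    ‖y‖⁻¹ • y ∈ normBase K (normSeminorm ℝ Y) :=
  ⟨hK.smul_mem (by positivity) hy, norm_smul_inv_norm (𝕜 := ℝ) hy0⟩

theorem normBase_subset_closure_convBase (K : Set Y) :
    normBase K (normSeminorm ℝ Y) ⊆ closure (convBase K (normSeminorm ℝ Y)) :=
  (subset_convexHull ℝ _).trans subset_closure

theorem closure_convBase_subset (hclosed : IsClosed K) (hconv : Convex ℝ K) :
    closure (convBase K (normSeminorm ℝ Y)) ⊆ K :=
  closure_minimal (convexHull_min (fun _ hy => hy.1) hconv) hclosed

theorem isBounded_convBase (K : Set Y) : Bornology.IsBounded (convBase K (normSeminorm ℝ Y)) := by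
  refine (Metric.isBounded_closedBall (x := (0 : Y)) (r := 1)).subset
    (convexHull_min (fun y hy => ?_) (convex_closedBall 0 1))
  exact mem_closedBall_zero_iff.2 hy.2.le

theorem exists_dual_norm_le (hK : IsCone K)
    (h0 : (0 : Y) ∉ closure (convBase K (normSeminorm ℝ Y))) :
    ∃ xs : StrongDual ℝ Y, ∀ y ∈ K, ‖y‖ ≤ xs y := by
  obtain ⟨g, u, hu0, hu⟩ := geometric_hahn_banach_point_closed
    (convex_convexHull ℝ _).closure isClosed_closure h0
  rw [map_zero] at hu0
  refine ⟨u⁻¹ • g, fun y hy => ?_⟩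
  rcases eq_or_ne y 0 with rfl | hy0
  · simp
  have hlt : u < ‖y‖⁻¹ * g y := by
    simpa using hu _ (normBase_subset_closure_convBase K (hK.inv_norm_smul_mem_normBase hy hy0))
  rw [lt_inv_mul_iff₀ (norm_pos_iff.2 hy0)] at hlt
  exact (le_inv_mul_iff₀' hu0).2 hlt.le

end Bases

section Angle

variable {Y : Type*} [SeminormedAddCommGroup Y]

/-- Two cones `A` and `D` are at a positive angle: the distance from a point of `A` to `D` is at
least a fixed positive multiple of its norm. -/
def PositiveAngle (A D : Set Y) : Prop :=
  ∃ ρ : ℝ, 0 < ρ ∧ ∀ a ∈ A, ∀ d ∈ D, ρ * ‖a‖ ≤ ‖a - d‖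

theorem PositiveAngle.symm {A D : Set Y} (h : PositiveAngle A D) : PositiveAngle D A := by
  obtain ⟨ρ, hρ, hangle⟩ := h
  refine ⟨ρ / (1 + ρ), by positivity, fun d hd a ha => ?_⟩
  have hd_le : ‖d‖ ≤ ‖a‖ + ‖d - a‖ := norm_le_norm_add_norm_sub' d a
  have ha_le : ρ * ‖a‖ ≤ ‖d - a‖ := norm_sub_rev d a ▸ hangle a ha d hd
  rw [div_mul_eq_mul_div, div_le_iff₀ (by positivity)]
  nlinarith

end Angle

section AngleOfCompactness

variable {Y : Type*} [NormedAddCommGroup Y] [NormedSpace ℝ Y] {A D S : Set Y}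

theorem positiveAngle_of_isClosed_sub (hA : IsCone A) (hD : IsCone D)
    (hbase : normBase A (normSeminorm ℝ Y) ⊆ S) (hclosed : IsClosed (S - D))
    (hdisj : Disjoint S D) : PositiveAngle A D := by
  have h0 : (0 : Y) ∉ S - D := by
    rintro ⟨s, hs, d, hd, hsd⟩
    exact Set.disjoint_left.1 hdisj hs (sub_eq_zero.1 hsd ▸ hd)
  obtain ⟨ρ, hρ, hball⟩ := Metric.isOpen_iff.1 hclosed.isOpen_compl 0 h0
  refine ⟨ρ, hρ, fun a ha d hd => ?_⟩
  rcases eq_or_ne a 0 with rfl | ha0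
  · simp
  have hmem : ‖a‖⁻¹ • (a - d) ∈ S - D := by
    rw [smul_sub]
    exact Set.sub_mem_sub (hbase (hA.inv_norm_smul_mem_normBase ha ha0))
      (hD.smul_mem (by positivity) hd)
  by_contra! hlt
  refine hball ?_ hmem
  rwa [mem_ball_zero_iff, norm_smul, norm_inv, norm_norm, inv_mul_lt_iff₀' (norm_pos_iff.2 ha0)]

theorem positiveAngle_of_isCompact_normBase (hA : IsCone A) (hD : IsCone D) (hDclosed : IsClosed D)
    (hAD : A ∩ D ⊆ {0}) (hcompact : IsCompact (normBase A (normSeminorm ℝ Y))) :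
    PositiveAngle A D := by
  refine positiveAngle_of_isClosed_sub hA hD subset_rfl ?_ ?_
  · rw [sub_eq_add_neg]
    exact hDclosed.neg.add_left_of_isCompact hcompact
  · refine Set.disjoint_left.2 fun a ha haD => ?_
    obtain rfl : a = 0 := hAD ⟨ha.1, haD⟩
    simpa using ha.2

theorem IsWeaklyCompact.isClosed_sub (hS : IsWeaklyCompact S) (hD : IsWeaklyClosed D) :
    IsClosed (S - D) := by
  have hweak : IsClosed (toWeakSpace ℝ Y '' (S - D)) := by
    rw [Set.image_sub, sub_eq_add_neg]
    exact IsClosed.add_left_of_isCompact (IsClosed.neg hD) hS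
  rw [← Set.preimage_image_eq (S - D) (toWeakSpace ℝ Y).injective]
  exact hweak.preimage (toWeakSpaceCLM ℝ Y).continuous

theorem positiveAngle_of_isWeaklyCompact_closure_convBase (hA : IsCone A) (hAclosed : IsClosed A)
    (hAconv : Convex ℝ A) (hD : IsCone D) (hDweak : IsWeaklyClosed D) (hAD : A ∩ D ⊆ {0})
    (h0 : (0 : Y) ∉ closure (convBase A (normSeminorm ℝ Y)))
    (hcompact : IsWeaklyCompact (closure (convBase A (normSeminorm ℝ Y)))) :
    PositiveAngle A D := by
  refine positiveAngle_of_isClosed_sub hA hD (normBase_subset_closure_convBase A)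
    (hcompact.isClosed_sub hDweak) (Set.disjoint_left.2 fun s hs hsD => ?_)
  obtain rfl : s = 0 := hAD ⟨closure_convBase_subset hAclosed hAconv hs, hsD⟩
  exact h0 hs

theorem IsReflexive.isWeaklyCompact_closure (hY : IsReflexive Y) (hS : Convex ℝ S)
    (hbounded : Bornology.IsBounded S) : IsWeaklyCompact (closure S) := by
  rw [IsWeaklyCompact, hS.toWeakSpace_closure ℝ]
  refine NormedSpace.isCompact_closure_of_isBounded ℝ Y _ ?_ fun F _ => ?_
  · rwa [Set.preimage_image_eq _ (toWeakSpace ℝ Y).injective]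
  · obtain ⟨y, hy⟩ := hY (WeakDual.toStrongDual F)
    exact ⟨toWeakSpace ℝ Y y, DFunLike.ext _ _ fun z => congrArg (fun G => G z) hy⟩

theorem positiveAngle_of_isCompact_or_isWeaklyClosed (hA : IsCone A) (hD : IsCone D)
    (hDclosed : IsClosed D) (hDconv : Convex ℝ D) (hAD : A ∩ D ⊆ {0})
    (h0 : (0 : Y) ∉ closure (convBase D (normSeminorm ℝ Y)))
    (hcond : IsCompact (normBase A (normSeminorm ℝ Y)) ∨
      (IsWeaklyClosed A ∧
        (IsReflexive Y ∨ IsWeaklyCompact (closure (convBase D (normSeminorm ℝ Y)))))) :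
    PositiveAngle A D := by
  rcases hcond with hcompact | ⟨hAweak, hcond⟩
  · exact positiveAngle_of_isCompact_normBase hA hD hDclosed hAD hcompact
  · have hcompact : IsWeaklyCompact (closure (convBase D (normSeminorm ℝ Y))) :=
      hcond.elim (fun hY => hY.isWeaklyCompact_closure (convex_convexHull ℝ _)
        (isBounded_convBase D)) id
    exact (positiveAngle_of_isWeaklyCompact_closure_convBase hD hDclosed hDconv hA hAweak
      (Set.inter_comm A D ▸ hAD) h0 hcompact).symm

end AngleOfCompactness

theorem infDist_le_norm {Y : Type*} [SeminormedAddCommGroup Y] {K : Set Y} (h0 : (0 : Y) ∈ K)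
    (y : Y) : Metric.infDist y K ≤ ‖y‖ :=
  dist_zero_right y ▸ Metric.infDist_le_dist_of_mem h0

section DilatingNorm

variable {Y : Type*} [NormedAddCommGroup Y] [NormedSpace ℝ Y] {K : Set Y}

theorem isSublinear_infDist (hK : IsCone K) (hconv : Convex ℝ K) :
    IsSublinear fun y => Metric.infDist y K := by
  have hne : K.Nonempty := ⟨0, hK.zero_mem⟩
  refine ⟨fun t y ht => ?_, fun y z => le_of_forall_pos_lt_add fun ε hε => ?_⟩
  · rcases ht.eq_or_lt with rfl | ht
    · simp [Metric.infDist_zero_of_mem hK.zero_mem]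
    · simpa only [hK.smul_set_eq ht, Real.norm_of_nonneg ht.le] using infDist_smul₀ ht.ne' K y
  · obtain ⟨u, hu, hyu⟩ := (Metric.infDist_lt_iff hne).1
      (lt_add_of_pos_right (Metric.infDist y K) (half_pos hε))
    obtain ⟨v, hv, hzv⟩ := (Metric.infDist_lt_iff hne).1
      (lt_add_of_pos_right (Metric.infDist z K) (half_pos hε))
    calc Metric.infDist (y + z) K
        ≤ dist (y + z) (u + v) := Metric.infDist_le_dist_of_mem (hK.add_mem hconv hu hv)
      _ ≤ dist y u + dist z v := dist_add_add_le y z u v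
      _ < Metric.infDist y K + Metric.infDist z K + ε := by linarith

theorem isSublinear_add_infDist (xs : StrongDual ℝ Y) (hK : IsCone K) (hconv : Convex ℝ K) :
    IsSublinear fun y => xs y + Metric.infDist y K :=
  IsSublinear.add ⟨fun t y _ => xs.map_smul t y, fun y z => (map_add xs y z).le⟩
    (isSublinear_infDist hK hconv)

/-- The seminorm `y ↦ max (x*(y) + d(y, K)) (-x*(y) + d(-y, K))`. If `x*` dominates the norm on
`K`, it is an equivalent norm and its Bishop–Phelps cones `C_p(x*, α)`, `α < 1`, are dilations of
`K` that shrink to the closure of `K` as `α` tends to `1`. -/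
noncomputable def dilatingNorm (xs : StrongDual ℝ Y) (hK : IsCone K) (hconv : Convex ℝ K) :
    Seminorm ℝ Y :=
  (isSublinear_add_infDist xs hK hconv).symmetrization

variable {xs : StrongDual ℝ Y}

theorem dilatingNorm_le_iff (hK : IsCone K) (hconv : Convex ℝ K) {y : Y} {c : ℝ} :
    dilatingNorm xs hK hconv y ≤ c ↔
      xs y + Metric.infDist y K ≤ c ∧ xs (-y) + Metric.infDist (-y) K ≤ c :=
  (isSublinear_add_infDist xs hK hconv).symmetrization_le_iff

theorem add_infDist_le_dilatingNorm (hK : IsCone K) (hconv : Convex ℝ K) (y : Y) :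
    xs y + Metric.infDist y K ≤ dilatingNorm xs hK hconv y :=
  ((dilatingNorm_le_iff hK hconv).1 le_rfl).1

theorem abs_apply_le_dilatingNorm (hK : IsCone K) (hconv : Convex ℝ K) (y : Y) :
    |xs y| ≤ dilatingNorm xs hK hconv y := by
  have hle (z : Y) : xs z ≤ dilatingNorm xs hK hconv z :=
    (le_add_of_nonneg_right Metric.infDist_nonneg).trans (add_infDist_le_dilatingNorm hK hconv z)
  refine abs_le'.2 ⟨hle y, ?_⟩
  simpa only [map_neg, map_neg_eq_map] using hle (-y)

theorem dilatingNorm_le_mul_norm (hK : IsCone K) (hconv : Convex ℝ K) (y : Y) :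
    dilatingNorm xs hK hconv y ≤ (‖xs‖ + 1) * ‖y‖ := by
  have hle (z : Y) : xs z + Metric.infDist z K ≤ (‖xs‖ + 1) * ‖z‖ := by
    rw [add_one_mul]
    exact add_le_add ((le_abs_self _).trans (xs.le_opNorm z)) (infDist_le_norm hK.zero_mem z)
  exact (dilatingNorm_le_iff hK hconv).2 ⟨hle y, norm_neg y ▸ hle (-y)⟩

theorem dilatingNorm_le_of_mem (hK : IsCone K) (hconv : Convex ℝ K) (hxs : ∀ u ∈ K, ‖u‖ ≤ xs u)
    {y : Y} (hy : y ∈ K) : dilatingNorm xs hK hconv y ≤ xs y := by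
  refine (dilatingNorm_le_iff hK hconv).2 ⟨by rw [Metric.infDist_zero_of_mem hy, add_zero], ?_⟩
  have hdist : Metric.infDist (-y) K ≤ ‖y‖ := norm_neg y ▸ infDist_le_norm hK.zero_mem (-y)
  rw [map_neg]
  linarith [hxs y hy, norm_nonneg y]

theorem norm_le_add_mul_infDist (hK : K.Nonempty) (hxs : ∀ u ∈ K, ‖u‖ ≤ xs u) (y : Y) :
    ‖y‖ ≤ xs y + (‖xs‖ + 1) * Metric.infDist y K := by
  suffices (‖y‖ - xs y) / (‖xs‖ + 1) ≤ Metric.infDist y K by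
    rw [div_le_iff₀' (by positivity)] at this
    linarith
  refine (Metric.le_infDist hK).2 fun u hu => ?_
  rw [div_le_iff₀' (by positivity), dist_eq_norm, sub_le_iff_le_add']
  have hxs_sub : xs u - xs y ≤ ‖xs‖ * ‖y - u‖ := by
    rw [← map_sub, norm_sub_rev]
    exact (le_abs_self _).trans (xs.le_opNorm _)
  calc ‖y‖ ≤ ‖u‖ + ‖y - u‖ := norm_le_norm_add_norm_sub' y u
    _ ≤ xs u + ‖y - u‖ := by gcongr; exact hxs u hu
    _ ≤ xs y + (‖xs‖ + 1) * ‖y - u‖ := by linarith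

theorem isEquivalentNorm_dilatingNorm (hK : IsCone K) (hconv : Convex ℝ K)
    (hxs : ∀ u ∈ K, ‖u‖ ≤ xs u) : IsEquivalentNorm (dilatingNorm xs hK hconv) := by
  refine ⟨(2 * ‖xs‖ + 3)⁻¹, ‖xs‖ + 1, by positivity, by positivity, fun y =>
    ⟨(inv_mul_le_iff₀ (by positivity)).2 ?_, dilatingNorm_le_mul_norm hK hconv y⟩⟩
  set p := dilatingNorm xs hK hconv
  have habs := abs_le.1 (abs_apply_le_dilatingNorm (xs := xs) hK hconv y)
  have hdist : Metric.infDist y K ≤ 2 * p y := by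
    linarith [add_infDist_le_dilatingNorm (xs := xs) hK hconv y]
  calc ‖y‖ ≤ xs y + (‖xs‖ + 1) * Metric.infDist y K := norm_le_add_mul_infDist ⟨0, hK.1⟩ hxs y
    _ ≤ p y + (‖xs‖ + 1) * (2 * p y) := by gcongr; exact habs.2
    _ = (2 * ‖xs‖ + 3) * p y := by ring

theorem mem_augQuasiDual_dilatingNorm (hK : IsCone K) (hconv : Convex ℝ K)
    (hxs : ∀ u ∈ K, ‖u‖ ≤ xs u) {α : ℝ} (hα0 : 0 ≤ α) (hα1 : α < 1) :
    (xs, α) ∈ augQuasiDual K (dilatingNorm xs hK hconv) := by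
  have hpos (y : Y) (hy : y ∈ K \ {0}) : 0 < xs y := (norm_pos_iff.2 hy.2).trans_le (hxs y hy.1)
  refine ⟨hpos, hα0, fun y hy => sub_pos.2 ?_⟩
  calc α * dilatingNorm xs hK hconv y
      ≤ α * xs y := mul_le_mul_of_nonneg_left (dilatingNorm_le_of_mem hK hconv hxs hy.1) hα0
    _ < xs y := mul_lt_of_lt_one_left (hpos y hy) hα1

theorem mul_infDist_le_of_mem_bpCone_dilatingNorm (hK : IsCone K) (hconv : Convex ℝ K) {α : ℝ}
    (hα : 0 ≤ α) {y : Y} (hy : y ∈ bpCone (dilatingNorm xs hK hconv) xs α) :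
    α * Metric.infDist y K ≤ (1 - α) * xs y := by
  have hle : α * (xs y + Metric.infDist y K) ≤ xs y :=
    (mul_le_mul_of_nonneg_left (add_infDist_le_dilatingNorm hK hconv y) hα).trans hy
  linarith

theorem exists_bpCone_dilatingNorm_inter_neg_subset (hK : IsCone K) (hconv : Convex ℝ K)
    {A : Set Y} (hangle : PositiveAngle A (-K)) :
    ∃ α : ℝ, 0 < α ∧ α < 1 ∧ bpCone (dilatingNorm xs hK hconv) xs α ∩ -A ⊆ {0} := by
  obtain ⟨ρ, hρ, hangle⟩ := hangle
  -- `α` solves `(1 - α) * (‖xs‖ + 1) = α * ρ`.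
  obtain ⟨α, hα⟩ : ∃ α, α = (‖xs‖ + 1) / (‖xs‖ + 1 + ρ) := ⟨_, rfl⟩
  have hα0 : 0 < α := hα ▸ by positivity
  have hα1 : α < 1 := hα ▸ (div_lt_one (by positivity)).2 (by linarith)
  have hbalance : (1 - α) * (‖xs‖ + 1) = α * ρ := by rw [hα]; field_simp; ring
  refine ⟨α, hα0, hα1, fun y ⟨hy, hyA⟩ => ?_⟩
  have hdist : ρ * ‖y‖ ≤ Metric.infDist y K := by
    refine (Metric.le_infDist ⟨0, hK.zero_mem⟩).2 fun u hu => ?_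
    simpa [dist_eq_norm, neg_add_eq_sub, norm_sub_rev] using
      hangle (-y) hyA (-u) (Set.neg_mem_neg.2 hu)
  have hle : (1 - α) * (‖xs‖ + 1) * ‖y‖ ≤ (1 - α) * ‖xs‖ * ‖y‖ := by
    calc (1 - α) * (‖xs‖ + 1) * ‖y‖ = α * (ρ * ‖y‖) := by rw [hbalance, mul_assoc]
      _ ≤ α * Metric.infDist y K := by gcongr
      _ ≤ (1 - α) * xs y := mul_infDist_le_of_mem_bpCone_dilatingNorm hK hconv hα0.le hy
      _ ≤ (1 - α) * (‖xs‖ * ‖y‖) :=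
        mul_le_mul_of_nonneg_left ((le_abs_self _).trans (xs.le_opNorm y))
          (sub_nonneg.2 hα1.le)
      _ = (1 - α) * ‖xs‖ * ‖y‖ := (mul_assoc _ _ _).symm
  have hnonpos : (1 - α) * ‖y‖ ≤ 0 := by linarith
  exact norm_le_zero_iff.1 (nonpos_of_mul_nonpos_right hnonpos (sub_pos.2 hα1))

theorem exists_bpCone_inter_neg_subset (hK : IsCone K) (hKconv : Convex ℝ K) {A : Set Y}
    (hK0 : (0 : Y) ∉ closure (convBase (-K) (normSeminorm ℝ Y))) (hangle : PositiveAngle A (-K)) :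
    ∃ p : Seminorm ℝ Y, IsEquivalentNorm p ∧ ∃ (xs : StrongDual ℝ Y) (α : ℝ),
      (xs, α) ∈ augQuasiDual K p ∧ 0 < α ∧ bpCone p xs α ∩ -A ⊆ {0} := by
  obtain ⟨xs, hxs⟩ : ∃ xs : StrongDual ℝ Y, ∀ u ∈ K, ‖u‖ ≤ xs u := by
    obtain ⟨g, hg⟩ := exists_dual_norm_le hK.neg hK0
    exact ⟨-g, fun u hu => by simpa using hg (-u) (Set.neg_mem_neg.2 hu)⟩
  obtain ⟨α, hα0, hα1, hsep⟩ := exists_bpCone_dilatingNorm_inter_neg_subset hK hKconv hangle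
  exact ⟨dilatingNorm xs hK hKconv, isEquivalentNorm_dilatingNorm hK hKconv hxs, xs, α,
    mem_augQuasiDual_dilatingNorm hK hKconv hxs hα0.le hα1, hα0, hsep⟩

end DilatingNorm

section Efficiency

variable {X Y : Type*} {Ω : Set X} {f : X → Y} {xb : X}

theorem sameValue_eq_argmin {β : Type*} [LinearOrder β] {g : Y → β} (hxb : xb ∈ Ω)
    (h : ∀ x ∈ Ω, g (f x) ≤ g (f xb) → f x = f xb) :
    sameValue Ω f xb = argmin Ω fun x => g (f x) := by
  ext x
  refine ⟨fun ⟨hx, hfx⟩ => ⟨hx, fun x' hx' => ?_⟩, fun ⟨hx, hmin⟩ => ⟨hx, h x hx (hmin xb hxb)⟩⟩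
  by_contra! hlt
  rw [hfx] at hlt
  exact hlt.ne (congrArg g (h x' hx' hlt.le))

variable [AddCommGroup Y] {A C : Set Y}

theorem mem_Eff_of_inter_neg_subset (hxb : xb ∈ Ω)
    (hsub : (fun x => f x - f xb) '' Ω ⊆ A) (hCA : C ∩ -A ⊆ {0}) : xb ∈ Eff Ω f C := by
  refine ⟨hxb, fun ⟨x, hx, hxC, hne⟩ => hne (hCA ⟨hxC, ?_⟩)⟩
  rw [Set.mem_neg, neg_sub]
  exact hsub ⟨x, hx, rfl⟩

theorem eq_of_mem_Eff (hxb : xb ∈ Eff Ω f C) {x : X} (hx : x ∈ Ω)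
    (h : f xb - f x ∈ C) : f x = f xb := by
  by_contra hne
  exact hxb.2 ⟨x, hx, h, fun h0 => hne (sub_eq_zero.1 h0).symm⟩

theorem sameValue_eq_argmin_of_isNegRepresenting (hxb : xb ∈ Eff Ω f C) {φ : Y → ℝ} (hφ0 : φ 0 = 0)
    (hφ : IsNegRepresenting φ C) : sameValue Ω f xb = argmin Ω fun x => φ (f x - f xb) := by
  refine sameValue_eq_argmin (g := fun y => φ (y - f xb)) hxb.1 fun x hx hle => ?_
  rw [sub_self, hφ0, hφ.nonpos_iff, neg_sub] at hle
  exact eq_of_mem_Eff hxb hx hle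

end Efficiency

section Scalarization

variable {X Y : Type*} [AddCommGroup Y] [Module ℝ Y] {Ω : Set X} {f : X → Y} {xb : X} {C : Set Y}
  {a k : Y} {s : ℝ}

theorem eq_and_eq_of_mem_psFeasible (hC : IsCone C) (hconv : Convex ℝ C) (hxb : xb ∈ Eff Ω f C)
    (hk : k ∈ C \ lineality C) {φ : Y → ℝ} (hφ : IsNegRepresenting φ C) (ha : a + s • k = f xb)
    {x : X} {l : ℝ} (hxl : (x, l) ∈ psFeasible Ω f φ a k) (hl : l ≤ s) : f x = f xb ∧ l = s := by
  obtain ⟨hx, hφx⟩ := hxl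
  have hmem : f xb - f x + (l - s) • k ∈ C := by
    convert (hφ.nonpos_iff _).1 hφx using 1
    rw [← ha]
    module
  have hval : f x = f xb := by
    refine eq_of_mem_Eff hxb hx ?_
    convert hC.add_mem hconv hmem (hC.smul_mem (sub_nonneg.2 hl) hk.1) using 1
    module
  rw [hval, sub_self, zero_add, hC.smul_mem_iff_nonneg hk, sub_nonneg] at hmem
  exact ⟨hval, hl.antisymm hmem⟩

theorem psSolutions_eq_sameValue_prod (hC : IsCone C) (hconv : Convex ℝ C) (hxb : xb ∈ Eff Ω f C)
    (hk : k ∈ C \ lineality C) {φ : Y → ℝ} (hφ : IsNegRepresenting φ C)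
    (ha : a + s • k = f xb) : psSolutions Ω f φ a k = sameValue Ω f xb ×ˢ {s} := by
  have hlow {x : X} {l : ℝ} : (x, l) ∈ psFeasible Ω f φ a k → l ≤ s → f x = f xb ∧ l = s :=
    eq_and_eq_of_mem_psFeasible hC hconv hxb hk hφ ha
  have hfeasible {x : X} (hx : x ∈ sameValue Ω f xb) : (x, s) ∈ psFeasible Ω f φ a k := by
    refine ⟨hx.1, (hφ.nonpos_iff _).2 ?_⟩
    simpa [hx.2, ← ha] using hC.zero_mem
  ext ⟨x, l⟩
  constructor
  · rintro ⟨hxl, hmin⟩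
    obtain ⟨hfx, hl⟩ := hlow hxl (hmin (xb, s) (hfeasible ⟨hxb.1, rfl⟩))
    exact ⟨⟨hxl.1, hfx⟩, hl⟩
  · rintro ⟨hx, rfl⟩
    refine ⟨hfeasible hx, fun ⟨x', l'⟩ hxl' => ?_⟩
    by_contra! hlt
    exact hlt.ne (hlow hxl' hlt.le).2

theorem gerstewitz_add_smul (hC : IsCone C) (hk : k ∈ C \ lineality C) (a : Y) (s : ℝ) :
    gerstewitz a C k (a + s • k) = s := by
  have hmem (t : ℝ) : t • k + a - (a + s • k) ∈ C ↔ s ≤ t := by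
    rw [← sub_nonneg, ← hC.smul_mem_iff_nonneg hk, sub_smul, add_comm a, add_sub_add_right_eq_sub]
  refine le_antisymm (sInf_le ⟨s, (hmem s).2 le_rfl, rfl⟩) (le_sInf ?_)
  rintro _ ⟨t, ht, rfl⟩
  exact EReal.coe_le_coe_iff.2 ((hmem t).1 ht)

variable [TopologicalSpace Y] [IsTopologicalAddGroup Y] [ContinuousSMul ℝ Y]

theorem gerstewitz_le_coe_iff (hC : IsCone C) (hconv : Convex ℝ C) (hclosed : IsClosed C)
    (hk : k ∈ C) {y : Y} : gerstewitz a C k y ≤ s ↔ s • k + a - y ∈ C := by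
  refine ⟨fun hle => ?_, fun h => sInf_le ⟨s, h, rfl⟩⟩
  have hlevels : IsClosed {t : ℝ | t • k + a - y ∈ C} := hclosed.preimage (by fun_prop)
  have habove : Set.Ioi s ⊆ {t : ℝ | t • k + a - y ∈ C} := by
    intro t hst
    obtain ⟨_, ⟨r, hr, rfl⟩, hrt⟩ := sInf_lt_iff.1 (hle.trans_lt (EReal.coe_lt_coe_iff.2 hst))
    have hrt : r ≤ t := (EReal.coe_lt_coe_iff.1 hrt).le
    change t • k + a - y ∈ C
    convert hC.add_mem hconv hr (hC.smul_mem (sub_nonneg.2 hrt) hk) using 1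
    module
  refine closure_minimal habove hlevels ?_
  rw [closure_Ioi, Set.mem_Ici]

theorem sameValue_eq_argmin_gerstewitz (hC : IsCone C) (hconv : Convex ℝ C) (hclosed : IsClosed C)
    (hxb : xb ∈ Eff Ω f C) (hk : k ∈ C \ lineality C) (ha : a + s • k = f xb) :
    sameValue Ω f xb = argmin Ω fun x => gerstewitz a C k (f x) := by
  refine sameValue_eq_argmin (g := gerstewitz a C k) hxb.1 fun x hx hle => ?_
  rw [← ha, gerstewitz_add_smul hC hk, gerstewitz_le_coe_iff hC hconv hclosed hk.1, add_comm, ha]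
    at hle
  exact eq_of_mem_Eff hxb hx hle

end Scalarization

end BPScal

theorem mainTheorem11_general {X Y : Type*} [NormedAddCommGroup Y] [NormedSpace ℝ Y]
    (Ω : Set X) (f : X → Y)
    (K : Set Y) (hK : IsCone K) (hKclosed : IsClosed K) (hKconv : Convex ℝ K)
    (hK0 : (0 : Y) ∉ closure (convBase (-K) (normSeminorm ℝ Y)))
    (A : Set Y) (hA : IsCone A) (hAK : A ∩ -K ⊆ {0})
    (xb : X) (hxb : xb ∈ Ω) (hsub : (fun x => f x - f xb) '' Ω ⊆ A)
    (hcond : IsCompact (normBase A (normSeminorm ℝ Y)) ∨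
      (IsWeaklyClosed A ∧
        (IsReflexive Y ∨ IsWeaklyCompact (closure (convBase (-K) (normSeminorm ℝ Y)))))) :
    ∃ p : Seminorm ℝ Y, IsEquivalentNorm p ∧
      ∃ (xs : StrongDual ℝ Y) (α : ℝ), (xs, α) ∈ augQuasiDual K p ∧ 0 < α ∧
        xb ∈ Eff Ω f (bpCone p xs α) ∧
        ∀ φ : Y → ℝ, φ 0 = 0 → IsNegRepresenting φ (bpCone p xs α) →
          (∀ k ∈ bpCone p xs α \ lineality (bpCone p xs α),
            psSolutions Ω f φ (f xb) k = sameValue Ω f xb ×ˢ {(0 : ℝ)}) ∧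
          sameValue Ω f xb = argmin Ω (fun x => φ (f x - f xb)) ∧
          ∀ (P T : Set Y) (R : Set ℝ),
            T ⊆ bpCone p xs α \ lineality (bpCone p xs α) →
            f '' Eff Ω f (bpCone p xs α) ⊆ P + R • T →
            (∃ a ∈ P, ∃ k ∈ T, ∃ s ∈ R,
              psSolutions Ω f φ a k = sameValue Ω f xb ×ˢ {s}) ∧
            (∃ a ∈ P, ∃ k ∈ T, ∃ s ∈ R,
              gerstewitz a (bpCone p xs α) k (f xb) = (s : EReal) ∧
              sameValue Ω f xb =
                argmin Ω (fun x => gerstewitz a (bpCone p xs α) k (f x))) := by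
  have hangle := positiveAngle_of_isCompact_or_isWeaklyClosed hA hK.neg hKclosed.neg hKconv.neg hAK
    hK0 hcond
  obtain ⟨p, hp, xs, α, hxsα, hα, hsep⟩ := exists_bpCone_inter_neg_subset hK hKconv hK0 hangle
  have hEff := mem_Eff_of_inter_neg_subset hxb hsub hsep
  have hC := isCone_bpCone p xs α
  have hconv := convex_bpCone p xs hα.le
  have hclosed := hp.isClosed_bpCone xs α
  refine ⟨p, hp, xs, α, hxsα, hα, hEff, fun φ hφ0 hφ => ⟨fun k hk => ?_,
    sameValue_eq_argmin_of_isNegRepresenting hEff hφ0 hφ, fun P T R hT hcover => ?_⟩⟩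
  · exact psSolutions_eq_sameValue_prod hC hconv hEff hk hφ (by simp)
  · obtain ⟨a, ha, _, ⟨s, hs, k, hk, rfl⟩, hask⟩ := hcover ⟨xb, hEff, rfl⟩
    exact ⟨⟨a, ha, k, hk, s, hs, psSolutions_eq_sameValue_prod hC hconv hEff (hT hk) hφ hask⟩,
      ⟨a, ha, k, hk, s, hs, hask ▸ gerstewitz_add_smul hC (hT hk) a s,
        sameValue_eq_argmin_gerstewitz hC hconv hclosed hEff (hT hk) hask⟩⟩

theorem mainTheorem11 {X Y : Type*} [NormedAddCommGroup Y] [NormedSpace ℝ Y]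
    (hdim : 2 ≤ Module.rank ℝ Y)
    (Ω : Set X) (f : X → Y)
    (K : Set Y) (hK : IsNontrivialCone K) (hKclosed : IsClosed K) (hKconv : Convex ℝ K)
    (hK0 : (0 : Y) ∉ closure (convBase (-K) (normSeminorm ℝ Y)))
    (𝔸 : X → Set Y) (h𝔸 : ∀ x ∈ Ω, IsCone (𝔸 x))
    (xb : X) (hxb : xb ∈ PEff 𝔸 Ω f K)
    (hne : (fun x => f x - f xb) '' Ω ≠ {0})
    (hsub : (fun x => f x - f xb) '' Ω ⊆ 𝔸 xb)
    (hcond :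
      (IsCompact (normBase (𝔸 xb) (normSeminorm ℝ Y)) ∧
        IsCompact (closure (convBase (-K) (normSeminorm ℝ Y)))) ∨
      (IsWeaklyClosed (𝔸 xb) ∧
        (IsReflexive Y ∨
          (IsWeaklyCompact (closure (convBase (-K) (normSeminorm ℝ Y))) ∧
            IsWeaklyCompact (weakClosure (normBase (𝔸 xb) (normSeminorm ℝ Y))) ∧
            (0 : Y) ∉ weakClosure (normBase (𝔸 xb) (normSeminorm ℝ Y)))))) :
    ∃ p : Seminorm ℝ Y, IsEquivalentNorm p ∧
      ∃ (xs : StrongDual ℝ Y) (α : ℝ), (xs, α) ∈ augQuasiDual K p ∧ 0 < α ∧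
        xb ∈ Eff Ω f (bpCone p xs α) ∧
        ∀ φ : Y → ℝ, IsSublinear φ → φ 0 = 0 → IsNegRepresenting φ (bpCone p xs α) →
          (∀ k ∈ bpCone p xs α \ lineality (bpCone p xs α),
            psSolutions Ω f φ (f xb) k = sameValue Ω f xb ×ˢ {(0 : ℝ)}) ∧
          sameValue Ω f xb = argmin Ω (fun x => φ (f x - f xb)) ∧
          ∀ (P T : Set Y) (R : Set ℝ),
            T ⊆ bpCone p xs α \ lineality (bpCone p xs α) →
            f '' Eff Ω f (bpCone p xs α) ⊆ P + R • T →
            (∃ a ∈ P, ∃ k ∈ T, ∃ s ∈ R,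
              psSolutions Ω f φ a k = sameValue Ω f xb ×ˢ {s}) ∧
            (∃ a ∈ P, ∃ k ∈ T, ∃ s ∈ R,
              gerstewitz a (bpCone p xs α) k (f xb) = (s : EReal) ∧
              sameValue Ω f xb =
                argmin Ω (fun x => gerstewitz a (bpCone p xs α) k (f x))) := by
  obtain ⟨p, hp, xs, α, hxsα, hα, hEff, h⟩ := mainTheorem11_general Ω f K hK.1 hKclosed hKconv hK0
    (𝔸 xb) (h𝔸 xb hxb.1.1) hxb.2.le xb hxb.1.1 hsub
    (hcond.imp And.left (And.imp_right (Or.imp_right And.left)))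
  exact ⟨p, hp, xs, α, hxsα, hα, hEff, fun φ _ => h φ⟩
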